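/- Let $Q$ be a finite group and let $\omega\in Z^3(Q,\mathrm{U}(1))$ be a normalized 3-cocycle with trivial action on $\mathrm{U}(1)$, i.e. a map $\omega:Q\times Q\times Q\to \mathrm{U}(1)$ that equals $1$ whenever one of its arguments is $1$ and satisfies $$\omega(h,k,l)\,\omega(g,hk,l)\,\omega(g,h,k)=\omega(gh,k,l)\,\omega(g,h,kl)\qquad (g,h,k,l\in Q).$$ Let $n>1$, let $\mathbb{F}_n\to Q$ be a surjective group homomorphism from the free group on $n$ generators, and put $m=|Q|(n-1)+1$. Let $B=C^*_r(\mathbb{F}_m)$ be the reduced group C*-algebra, i.e. the norm closure in $B(\ell^2(\mathbb{F}_m))$ of the $*$-algebra generated by the left regular representation. Then there exists an $\omega$-anomalous action of $Q$ on $B$: there are $*$-automorphisms $\alpha_g\in\mathrm{Aut}(B)$ for $g\in Q$ and unitaries $u_{g,h}\in B$ for $g,h\in Q$ such that for all $g,h,k\in Q$ and all $x\in B$ $$u_{g,h}\,\alpha_g(\alpha_h(x))=\alpha_{gh}(x)\,u_{g,h},\qquad \omega(g,h,k)\,u_{gh,k}\,u_{g,h}=u_{g,hk}\,\alpha_g(u_{h,k}).$$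 -/

import Mathlib

open scoped ENNReal

/-- `ω` is a normalized 3-cocycle of the group `Q` with values in `U(1)`
(trivial action, written multiplicatively): it is `1` whenever one argument is `1`,
and its coboundary is trivial. -/
structure IsNormalizedThreeCocycle {Q : Type*} [Group Q] (ω : Q → Q → Q → Circle) : Prop where
  map_one_left : ∀ h k, ω 1 h k = 1
  map_one_mid : ∀ g k, ω g 1 k = 1
  map_one_right : ∀ g h, ω g h 1 = 1
  cocycle : ∀ g h k l,
    ω h k l * ω g (h * k) l * ω g h k = ω (g * h) k l * ω g h (k * l)

/-- An `ω`-anomalous action of a group `Q` on a unital C⋆-algebra `B`: automorphisms `α g` and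
unitaries `m g h` of `B` (which is its own multiplier algebra) such that
`m g h` intertwines `α g ∘ α h` and `α (g * h)`, and
`ω(g,h,k) m_{gh,k} m_{g,h} = m_{g,hk} α_g(m_{h,k})`. -/
structure AnomalousAction {Q : Type*} [Group Q] (ω : Q → Q → Q → Circle)
    (B : Type*) [CStarAlgebra B] where
  /-- the automorphisms -/
  α : Q → (B ≃⋆ₐ[ℂ] B)
  /-- the unitaries -/
  m : Q → Q → unitary B
  intertwine : ∀ (g h : Q) (x : B), (m g h : B) * α g (α h x) = α (g * h) x * (m g h : B)
  anomaly : ∀ g h k : Q,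
    (ω g h k : ℂ) • ((m (g * h) k : B) * (m g h : B)) = (m g (h * k) : B) * α g (m h k : B)

/-- The Hilbert space `ℓ²(G)`. -/
abbrev EllTwo (G : Type*) : Type _ := lp (fun _ : G => ℂ) 2

/-- Precomposition with a permutation preserves `ℓ²`. -/
theorem memlp_two_comp_equiv {G : Type*} (e : G ≃ G) (f : EllTwo G) :
    Memℓp (fun x => f (e x)) 2 := by
  have h := (memℓp_gen_iff (p := 2) (by norm_num)).1 (lp.memℓp f)
  exact memℓp_gen ((e.summable_iff (f := fun x => ‖f x‖ ^ (2 : ℝ≥0∞).toReal)).2 h)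

/-- The left regular representation of `G` on `ℓ²(G)`:
`(leftRegular g f) x = f (g⁻¹ * x)`. -/
noncomputable def leftRegular {G : Type*} [Group G] (g : G) : EllTwo G →L[ℂ] EllTwo G :=
  LinearMap.mkContinuous
    { toFun := fun f => ⟨fun x => f (g⁻¹ * x), memlp_two_comp_equiv (Equiv.mulLeft g⁻¹) f⟩
      map_add' := fun _ _ => rfl
      map_smul' := fun _ _ => rfl } 1 (by
    intro f
    rw [one_mul, lp.norm_eq_tsum_rpow (by norm_num), lp.norm_eq_tsum_rpow (by norm_num)]
    exact (congrArg (· ^ (1 / (2 : ℝ≥0∞).toReal))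
      ((Equiv.mulLeft g⁻¹).tsum_eq (fun x => ‖f x‖ ^ (2 : ℝ≥0∞).toReal))).le)

/-- The reduced group C⋆-algebra `C*_r(G)`: the norm closure in `B(ℓ²(G))` of the
⋆-subalgebra generated by the left translations. -/
noncomputable def reducedGroupCStarAlgebra (G : Type*) [Group G] :
    StarSubalgebra ℂ (EllTwo G →L[ℂ] EllTwo G) :=
  (StarAlgebra.adjoin ℂ (Set.range (leftRegular (G := G)))).topologicalClosure

noncomputable instance (G : Type*) [Group G] : CStarAlgebra (reducedGroupCStarAlgebra G) :=
  StarSubalgebra.cstarAlgebra _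
    (h_closed := StarSubalgebra.isClosed_topologicalClosure _)

/-! ### The regular representation and its twisted automorphisms -/

section RegularRepresentation

variable {G : Type*}

/-! The kernel K of `ρ` is free of rank m, so it suffices to let Q act anomalously on C*_r(K).
Conjugation by a set-theoretic lift s(g) preserves K, but the lifts compose only up to the elements
s(gh)s(h)⁻¹s(g)⁻¹ of K, so translations by these are the natural unitaries; this action has no
anomaly. The anomaly comes from phases: ω becomes a coboundary on the free group, through a cochain
C(g, a) with g in Q and a in the free group (`exists_trivialization`). Each C(g, ·) is a character
on K that twists conjugation by s(g), and C(g, s(h))⁻¹ scales the unitaries.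

C exists by dimension shifting: ω defines an extension of Q by normalized functions Q → U(1), and
any homomorphism from a free group to Q lifts to it. The rank of K follows from counting ℤ/2-valued
cocycles of the action groupoid of the free group on Q in two ways. -/

theorem memlp_two_weighted_comp_equiv (e : G ≃ G) (z : G → Circle) (f : EllTwo G) :
    Memℓp (fun x => (z x : ℂ) * f (e x)) 2 := by
  refine memℓp_gen ?_
  simpa [Circle.norm_coe] using
    (memℓp_gen_iff (p := 2) (by norm_num)).1 (memlp_two_comp_equiv e f)

/-- The unitary operator of `ℓ²(G)` that permutes the coordinates by `e` and multiplies them by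
the phases `z`. -/
noncomputable def weightedPerm (e : G ≃ G) (z : G → Circle) : EllTwo G ≃ₗᵢ[ℂ] EllTwo G where
  toFun f := ⟨fun x => (z x : ℂ) * f (e.symm x), memlp_two_weighted_comp_equiv e.symm z f⟩
  invFun f := ⟨fun x => (((z (e x))⁻¹ : Circle) : ℂ) * f (e x),
    memlp_two_weighted_comp_equiv e (fun x => (z (e x))⁻¹) f⟩
  map_add' f g := by
    ext x
    exact mul_add _ _ _
  map_smul' c f := by
    ext x
    simp [mul_left_comm]
  left_inv f := by
    ext x
    simp
  right_inv f := by
    ext x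
    simp
  norm_map' f := by
    rw [lp.norm_eq_tsum_rpow (by norm_num), lp.norm_eq_tsum_rpow (by norm_num)]
    refine congrArg (· ^ (1 / (2 : ℝ≥0∞).toReal)) ?_
    simpa [Circle.norm_coe] using e.symm.tsum_eq (fun x => ‖f x‖ ^ (2 : ℝ≥0∞).toReal)

@[simp]
theorem weightedPerm_apply (e : G ≃ G) (z : G → Circle) (f : EllTwo G) (x : G) :
    weightedPerm e z f x = (z x : ℂ) * f (e.symm x) := rfl

@[simp]
theorem weightedPerm_symm_apply (e : G ≃ G) (z : G → Circle) (f : EllTwo G) (x : G) :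
    (weightedPerm e z).symm f x = (((z (e x))⁻¹ : Circle) : ℂ) * f (e x) := rfl

variable [Group G]

@[simp]
theorem leftRegular_apply (g : G) (f : EllTwo G) (x : G) : leftRegular g f x = f (g⁻¹ * x) := rfl

theorem leftRegular_one : leftRegular (1 : G) = 1 := by
  ext f x
  simp

theorem leftRegular_mul (g h : G) : leftRegular (g * h) = leftRegular g * leftRegular h := by
  ext f x
  simp [mul_assoc]

theorem star_leftRegular (g : G) : star (leftRegular g) = leftRegular g⁻¹ := by
  have h₁ : leftRegular g =
      ((weightedPerm (Equiv.mulLeft g) 1 : EllTwo G ≃ₗᵢ[ℂ] EllTwo G) :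
        EllTwo G →L[ℂ] EllTwo G) := by
    ext f x
    simp
  rw [h₁, LinearIsometryEquiv.star_eq_symm]
  ext f x
  simp

theorem leftRegular_mem (g : G) : leftRegular g ∈ reducedGroupCStarAlgebra G :=
  StarSubalgebra.le_topologicalClosure _ (StarAlgebra.subset_adjoin ℂ _ ⟨g, rfl⟩)

/-- Reduces membership and equality statements to the translations alone. -/
theorem reducedGroupCStarAlgebra_le {S : StarSubalgebra ℂ (EllTwo G →L[ℂ] EllTwo G)}
    (hS : IsClosed (S : Set (EllTwo G →L[ℂ] EllTwo G))) (h : ∀ g, leftRegular g ∈ S) :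
    reducedGroupCStarAlgebra G ≤ S :=
  StarSubalgebra.topologicalClosure_minimal
    (StarAlgebra.adjoin_le (by rintro _ ⟨g, rfl⟩; exact h g)) hS

/-- Continuous ⋆-homomorphisms that agree on the left translations agree on `C*_r(G)`. -/
theorem eqOn_reducedGroupCStarAlgebra {A : Type*} [Ring A] [StarRing A] [Algebra ℂ A]
    [StarModule ℂ A] [TopologicalSpace A] [T2Space A]
    {Φ Ψ : (EllTwo G →L[ℂ] EllTwo G) →⋆ₐ[ℂ] A}
    (hΦ : Continuous Φ) (hΨ : Continuous Ψ) (h : ∀ g, Φ (leftRegular g) = Ψ (leftRegular g))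
    {x : EllTwo G →L[ℂ] EllTwo G} (hx : x ∈ reducedGroupCStarAlgebra G) : Φ x = Ψ x :=
  reducedGroupCStarAlgebra_le (S := StarAlgHom.equalizer Φ Ψ) (isClosed_eq hΦ hΨ) h hx

/-- The ⋆-automorphism of `B(ℓ²(G))` that sends the translation by `k` to `χ k` times
the translation by `φ k`. -/
noncomputable def twistedConj (φ : G ≃* G) (χ : G →* Circle) :
    (EllTwo G →L[ℂ] EllTwo G) ≃⋆ₐ[ℂ] (EllTwo G →L[ℂ] EllTwo G) :=
  (weightedPerm φ.toEquiv (fun x => χ (φ.symm x))).conjStarAlgEquiv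

theorem continuous_twistedConj (φ : G ≃* G) (χ : G →* Circle) :
    Continuous (twistedConj φ χ) :=
  (ContinuousLinearEquiv.conjContinuousAlgEquiv _).continuous

theorem continuous_twistedConj_symm (φ : G ≃* G) (χ : G →* Circle) :
    Continuous (twistedConj φ χ).symm :=
  (ContinuousLinearEquiv.conjContinuousAlgEquiv _).symm.continuous

theorem twistedConj_leftRegular (φ : G ≃* G) (χ : G →* Circle) (k : G) :
    twistedConj φ χ (leftRegular k) = (χ k : ℂ) • leftRegular (φ k) := by
  ext f x
  change (weightedPerm φ.toEquiv (fun x => χ (φ.symm x)))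
    (leftRegular k ((weightedPerm φ.toEquiv (fun x => χ (φ.symm x))).symm f)) x = _
  simp [← mul_assoc]

theorem twistedConj_symm_leftRegular (φ : G ≃* G) (χ : G →* Circle) (k : G) :
    (twistedConj φ χ).symm (leftRegular k) =
      (((χ (φ.symm k))⁻¹ : Circle) : ℂ) • leftRegular (φ.symm k) := by
  rw [StarAlgEquiv.symm_apply_eq, map_smul, twistedConj_leftRegular, smul_smul]
  simp

theorem twistedConj_mem (φ : G ≃* G) (χ : G →* Circle) {x : EllTwo G →L[ℂ] EllTwo G}
    (hx : x ∈ reducedGroupCStarAlgebra G) : twistedConj φ χ x ∈ reducedGroupCStarAlgebra G := by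
  refine reducedGroupCStarAlgebra_le
    (S := (reducedGroupCStarAlgebra G).comap (twistedConj φ χ).toStarAlgHom) ?_ (fun k => ?_) hx
  · exact (StarSubalgebra.isClosed_topologicalClosure _).preimage (continuous_twistedConj φ χ)
  · change twistedConj φ χ (leftRegular k) ∈ reducedGroupCStarAlgebra G
    rw [twistedConj_leftRegular]
    exact SMulMemClass.smul_mem _ (leftRegular_mem _)

theorem twistedConj_symm_mem (φ : G ≃* G) (χ : G →* Circle) {x : EllTwo G →L[ℂ] EllTwo G}
    (hx : x ∈ reducedGroupCStarAlgebra G) :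
    (twistedConj φ χ).symm x ∈ reducedGroupCStarAlgebra G := by
  refine reducedGroupCStarAlgebra_le
    (S := (reducedGroupCStarAlgebra G).comap (twistedConj φ χ).symm.toStarAlgHom) ?_
    (fun k => ?_) hx
  · exact (StarSubalgebra.isClosed_topologicalClosure _).preimage (continuous_twistedConj_symm φ χ)
  · change (twistedConj φ χ).symm (leftRegular k) ∈ reducedGroupCStarAlgebra G
    rw [twistedConj_symm_leftRegular]
    exact SMulMemClass.smul_mem _ (leftRegular_mem _)

/-- The restriction of `twistedConj φ χ` to `C*_r(G)`. -/
noncomputable def twistedAut (φ : G ≃* G) (χ : G →* Circle) :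
    reducedGroupCStarAlgebra G ≃⋆ₐ[ℂ] reducedGroupCStarAlgebra G where
  toFun x := ⟨twistedConj φ χ x, twistedConj_mem φ χ x.2⟩
  invFun x := ⟨(twistedConj φ χ).symm x, twistedConj_symm_mem φ χ x.2⟩
  left_inv x := Subtype.ext ((twistedConj φ χ).symm_apply_apply x)
  right_inv x := Subtype.ext ((twistedConj φ χ).apply_symm_apply x)
  map_mul' x y := Subtype.ext (map_mul (twistedConj φ χ) (x : EllTwo G →L[ℂ] EllTwo G) y)
  map_add' x y := Subtype.ext (map_add (twistedConj φ χ) (x : EllTwo G →L[ℂ] EllTwo G) y)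
  map_star' x := Subtype.ext (map_star (twistedConj φ χ) (x : EllTwo G →L[ℂ] EllTwo G))
  map_smul' c x := Subtype.ext (map_smul (twistedConj φ χ) c (x : EllTwo G →L[ℂ] EllTwo G))

/-- The multiple of a left translation by a phase, as a unitary of `B(ℓ²(G))`. -/
noncomputable def phaseTranslation (z : Circle) (w : G) : unitary (EllTwo G →L[ℂ] EllTwo G) :=
  ⟨(z : ℂ) • leftRegular w, by
    rw [Unitary.mem_iff, star_smul, star_leftRegular, smul_mul_smul_comm, smul_mul_smul_comm,
      ← leftRegular_mul, ← leftRegular_mul, inv_mul_cancel, mul_inv_cancel, leftRegular_one]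
    constructor
    · rw [Complex.star_def, ← Circle.coe_inv_eq_conj, ← Circle.coe_mul]
      simp
    · rw [Complex.star_def, ← Circle.coe_inv_eq_conj, ← Circle.coe_mul]
      simp⟩

theorem coe_phaseTranslation (z : Circle) (w : G) :
    (phaseTranslation z w : EllTwo G →L[ℂ] EllTwo G) = (z : ℂ) • leftRegular w := rfl

/-- The multiple of a left translation by a phase, as a unitary of `C*_r(G)`. -/
noncomputable def phaseUnitary (z : Circle) (w : G) : unitary (reducedGroupCStarAlgebra G) :=
  ⟨⟨(z : ℂ) • leftRegular w, SMulMemClass.smul_mem _ (leftRegular_mem w)⟩,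
    Unitary.mem_iff.2 ⟨Subtype.ext (Unitary.mem_iff.1 (phaseTranslation z w).2).1,
      Subtype.ext (Unitary.mem_iff.1 (phaseTranslation z w).2).2⟩⟩

theorem phase_smul_mul (y z : Circle) (v w : G) :
    ((y : ℂ) • leftRegular v) * ((z : ℂ) • leftRegular w) =
      ((y * z : Circle) : ℂ) • leftRegular (v * w) := by
  rw [smul_mul_smul_comm, leftRegular_mul, Circle.coe_mul]

/-- Data on the group level that produce an anomalous action on the reduced group C⋆-algebra. -/
noncomputable def AnomalousAction.ofTwists {Q : Type*} [Group Q] {ω : Q → Q → Q → Circle}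
    (φ : Q → G ≃* G) (χ : Q → G →* Circle) (w : Q → Q → G) (z : Q → Q → Circle)
    (hφ : ∀ g h k, w g h * φ g (φ h k) = φ (g * h) k * w g h)
    (hχ : ∀ g h k, χ h k * χ g (φ h k) = χ (g * h) k)
    (hw : ∀ g h k, w (g * h) k * w g h = w g (h * k) * φ g (w h k))
    (hz : ∀ g h k, ω g h k * (z (g * h) k * z g h) = z g (h * k) * (z h k * χ g (w h k))) :
    AnomalousAction ω (reducedGroupCStarAlgebra G) where
  α g := twistedAut (φ g) (χ g)
  m g h := phaseUnitary (z g h) (w g h)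
  intertwine g h x := by
    refine Subtype.ext ?_
    change ((z g h : ℂ) • leftRegular (w g h)) *
        twistedConj (φ g) (χ g) (twistedConj (φ h) (χ h) x) =
      twistedConj (φ (g * h)) (χ (g * h)) x * ((z g h : ℂ) • leftRegular (w g h))
    rw [← coe_phaseTranslation]
    set u := phaseTranslation (z g h) (w g h) with hu
    -- Conjugating by `u` turns the intertwining relation into an equality of ⋆-homomorphisms, which
    -- can be tested on translations.
    have key := eqOn_reducedGroupCStarAlgebra
      (Φ := (((twistedConj (φ h) (χ h)).trans (twistedConj (φ g) (χ g))).trans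
        (Unitary.conjStarAlgAut ℂ _ u)).toStarAlgHom)
      (Ψ := (twistedConj (φ (g * h)) (χ (g * h))).toStarAlgHom) ?_ ?_ ?_ x.2
    · change (u : EllTwo G →L[ℂ] EllTwo G) * twistedConj (φ g) (χ g)
        (twistedConj (φ h) (χ h) x) * (star u : EllTwo G →L[ℂ] EllTwo G) =
          twistedConj (φ (g * h)) (χ (g * h)) x at key
      rw [← key, mul_assoc _ _ (u : EllTwo G →L[ℂ] EllTwo G)]
      simp
    · change Continuous fun x => (u : EllTwo G →L[ℂ] EllTwo G) * twistedConj (φ g) (χ g)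
        (twistedConj (φ h) (χ h) x) * (star u : EllTwo G →L[ℂ] EllTwo G)
      have := (continuous_twistedConj (φ g) (χ g)).comp (continuous_twistedConj (φ h) (χ h))
      exact (continuous_const.mul this).mul continuous_const
    · exact continuous_twistedConj _ _
    · intro k
      change (u : EllTwo G →L[ℂ] EllTwo G) * twistedConj (φ g) (χ g)
        (twistedConj (φ h) (χ h) (leftRegular k)) * (star u : EllTwo G →L[ℂ] EllTwo G) =
          twistedConj (φ (g * h)) (χ (g * h)) (leftRegular k)
      have h₁ : (u : EllTwo G →L[ℂ] EllTwo G) * twistedConj (φ g) (χ g)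
          (twistedConj (φ h) (χ h) (leftRegular k)) =
            twistedConj (φ (g * h)) (χ (g * h)) (leftRegular k) * u := by
        rw [hu, coe_phaseTranslation, twistedConj_leftRegular, map_smul, twistedConj_leftRegular,
          twistedConj_leftRegular, smul_smul, ← Circle.coe_mul, phase_smul_mul, phase_smul_mul,
          hφ, hχ, mul_comm (z g h)]
      rw [h₁, mul_assoc]
      simp
  anomaly g h k := by
    refine Subtype.ext ?_
    change (ω g h k : ℂ) • (((z (g * h) k : ℂ) • leftRegular (w (g * h) k)) *
        ((z g h : ℂ) • leftRegular (w g h))) =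
      ((z g (h * k) : ℂ) • leftRegular (w g (h * k))) *
        twistedConj (φ g) (χ g) ((z h k : ℂ) • leftRegular (w h k))
    rw [map_smul, twistedConj_leftRegular, smul_smul, phase_smul_mul, ← Circle.coe_mul,
      phase_smul_mul, smul_smul, ← Circle.coe_mul, hw, hz]

end RegularRepresentation

/-! ### Trivializing the pullback of a 3-cocycle to a free group -/

section CocycleTrivialization

variable {Q : Type*} [Group Q] {ω : Q → Q → Q → Circle}

theorem IsNormalizedThreeCocycle.inv (hω : IsNormalizedThreeCocycle ω) :
    IsNormalizedThreeCocycle fun g h k => (ω g h k)⁻¹ where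
  map_one_left h k := by simp [hω.map_one_left]
  map_one_mid g k := by simp [hω.map_one_mid]
  map_one_right g h := by simp [hω.map_one_right]
  cocycle g h k l := by
    rw [← mul_inv, ← mul_inv, ← mul_inv, hω.cocycle]

/-- Pairs of a normalized 1-cochain `Q → U(1)` and an element of `Q`. A normalized 3-cocycle turns
this type into an extension of `Q` by the normalized 1-cochains. -/
@[ext]
structure CochainExtension (Q : Type*) [Group Q] where
  /-- the cochain -/
  fn : Q → Circle
  /-- the element of the quotient -/
  base : Q
  fn_one : fn 1 = 1

/-- The group structure on `CochainExtension Q` given by the cocycle `ω`. -/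
noncomputable abbrev IsNormalizedThreeCocycle.group (hω : IsNormalizedThreeCocycle ω) :
    Group (CochainExtension Q) :=
  -- The last factor restores the value 1 at `g = 1`: normalized functions stand for functions
  -- modulo constants.
  letI : Mul (CochainExtension Q) :=
    ⟨fun a b => ⟨fun g => ω g a.base b.base * a.fn g * b.fn (g * a.base) * (b.fn a.base)⁻¹,
      a.base * b.base, by simp [hω.map_one_left, a.fn_one]⟩⟩
  letI : One (CochainExtension Q) := ⟨⟨fun _ => 1, 1, rfl⟩⟩
  letI : Inv (CochainExtension Q) :=
    ⟨fun a => ⟨fun g => (ω g a.base⁻¹ a.base)⁻¹ * (a.fn (g * a.base⁻¹))⁻¹ * a.fn a.base⁻¹,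
      a.base⁻¹, by simp [hω.map_one_left]⟩⟩
  Group.ofLeftAxioms
    (fun a b c => by
      refine CochainExtension.ext (funext fun g => ?_) (mul_assoc _ _ _)
      change ω g (a.base * b.base) c.base *
          (ω g a.base b.base * a.fn g * b.fn (g * a.base) * (b.fn a.base)⁻¹) *
          c.fn (g * (a.base * b.base)) * (c.fn (a.base * b.base))⁻¹ =
        ω g a.base (b.base * c.base) * a.fn g *
          (ω (g * a.base) b.base c.base * b.fn (g * a.base) * c.fn (g * a.base * b.base) *
            (c.fn b.base)⁻¹) *
          (ω a.base b.base c.base * b.fn a.base * c.fn (a.base * b.base) * (c.fn b.base)⁻¹)⁻¹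
      -- The factor ω(a, b, c) needed here comes from the normalizing factors; modulo constants it
      -- would be invisible.
      have h := congrArg ((↑) : Circle → ℂ) (hω.cocycle g a.base b.base c.base)
      rw [mul_assoc g]
      ext
      push_cast at h ⊢
      have h₁ := (b.fn a.base).coe_ne_zero
      have h₂ := (c.fn b.base).coe_ne_zero
      have h₃ := (c.fn (a.base * b.base)).coe_ne_zero
      have h₄ := (ω a.base b.base c.base).coe_ne_zero
      field_simp
      linear_combination h)
    (fun a => by
      refine CochainExtension.ext (funext fun g => ?_) (one_mul _)
      change ω g 1 a.base * 1 * a.fn (g * 1) * (a.fn 1)⁻¹ = a.fn g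
      simp [hω.map_one_mid, a.fn_one])
    (fun a => by
      refine CochainExtension.ext (funext fun g => ?_) (inv_mul_cancel _)
      change ω g a.base⁻¹ a.base *
        ((ω g a.base⁻¹ a.base)⁻¹ * (a.fn (g * a.base⁻¹))⁻¹ * a.fn a.base⁻¹) *
          a.fn (g * a.base⁻¹) * (a.fn a.base⁻¹)⁻¹ = 1
      ext
      push_cast
      have h₁ := (ω g a.base⁻¹ a.base).coe_ne_zero
      have h₂ := (a.fn (g * a.base⁻¹)).coe_ne_zero
      have h₃ := (a.fn a.base⁻¹).coe_ne_zero
      field_simp)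

/-- The pullback of a 3-cocycle along a homomorphism from a free group is the coboundary of
a 2-cochain whose first argument only depends on its image in `Q`. -/
theorem IsNormalizedThreeCocycle.exists_trivialization (hω : IsNormalizedThreeCocycle ω)
    {X : Type*} (ρ : FreeGroup X →* Q) :
    ∃ C : Q → FreeGroup X → Circle, (∀ b, C 1 b = 1) ∧
      ∀ g a b, C g (a * b) * C (ρ a) b = ω g (ρ a) (ρ b) * (C g a * C (g * ρ a) b) := by
  let _ := hω.group
  let σ : FreeGroup X →* CochainExtension Q :=
    FreeGroup.lift fun x => ⟨fun _ => 1, ρ (FreeGroup.of x), rfl⟩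
  let π : CochainExtension Q →* Q := ⟨⟨fun a => a.base, rfl⟩, fun _ _ => rfl⟩
  have hσ : ∀ a, (σ a).base = ρ a := by
    have : π.comp σ = ρ := by
      ext x
      simp [σ, π]
    exact fun a => DFunLike.congr_fun this a
  refine ⟨fun g a => (σ a).fn g, fun b => (σ b).fn_one, fun g a b => ?_⟩
  have h : (σ (a * b)).fn g =
      ω g (σ a).base (σ b).base * (σ a).fn g * (σ b).fn (g * (σ a).base) *
        ((σ b).fn (σ a).base)⁻¹ := by
    rw [map_mul]
    rfl
  rw [hσ, hσ] at h
  beta_reduce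
  rw [h, inv_mul_cancel_right, mul_assoc]

/-- An anomalous action of a quotient of a free group on the reduced C⋆-algebra of the kernel. -/
theorem IsNormalizedThreeCocycle.nonempty_anomalousAction (hω : IsNormalizedThreeCocycle ω)
    {X : Type*} {ρ : FreeGroup X →* Q} (hρ : Function.Surjective ρ)
    {G : Type*} [Group G] (e : G ≃* ρ.ker) :
    Nonempty (AnomalousAction ω (reducedGroupCStarAlgebra G)) := by
  -- The inverse cocycle is used because the phases of the unitaries are inverses of values of `C`.
  obtain ⟨C, hC₁, hC⟩ := hω.inv.exists_trivialization ρ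
  obtain ⟨s, hs⟩ := hρ.hasRightInverse
  have hker : ∀ k : G, ρ (e k) = 1 := fun k => (e k).2
  have hC_right : ∀ g a (k : FreeGroup X), ρ k = 1 →
      C g (a * k) * C (ρ a) k = C g a * C (g * ρ a) k := by
    intro g a k hk
    rw [hC, hk, hω.inv.map_one_right, one_mul]
  have hC_left : ∀ g (k : FreeGroup X) b, ρ k = 1 → C g (k * b) = C g k * C g b := by
    intro g k b hk
    simpa [hk, hC₁, hω.map_one_mid] using hC g k b
  let φ : Q → G ≃* G := fun g => (e.trans (MulAut.conjNormal (s g))).trans e.symm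
  have heφ : ∀ g k, (e (φ g k) : FreeGroup X) = s g * e k * (s g)⁻¹ := by
    intro g k
    simp [φ]
  let χ : Q → G →* Circle := fun g =>
    ⟨⟨fun k => C g (e k), by
      have := hC_left g 1 1 (map_one ρ)
      simpa using this⟩, fun k l => by
        simpa using hC_left g (e k) (e l) (hker k)⟩
  let w : Q → Q → G := fun g h => e.symm ⟨s (g * h) * (s h)⁻¹ * (s g)⁻¹, by
    simp [MonoidHom.mem_ker, hs _]⟩
  have hew : ∀ g h, (e (w g h) : FreeGroup X) = s (g * h) * (s h)⁻¹ * (s g)⁻¹ := by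
    intro g h
    simp [w]
  refine ⟨AnomalousAction.ofTwists φ χ w (fun g h => (C g (s h))⁻¹) ?_ ?_ ?_ ?_⟩
  · intro g h k
    apply e.injective
    ext1
    simp only [map_mul, Subgroup.coe_mul, hew, heφ]
    group
  · intro g h k
    change C h (e k) * C g (e (φ h k)) = C (g * h) (e k)
    -- Expand `C g` at s(h)k = (s(h)ks(h)⁻¹)s(h) in both ways.
    have h₁ := hC_right g (s h) (e k) (hker k)
    have h₂ := hC_left g (e (φ h k)) (s h) (hker _)
    rw [heφ, inv_mul_cancel_right] at h₂
    rw [h₂, hs, mul_comm (C g _), mul_assoc, mul_right_inj] at h₁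
    rw [heφ, ← h₁, mul_comm]
  · intro g h k
    apply e.injective
    ext1
    simp only [map_mul, Subgroup.coe_mul, hew, heφ, mul_assoc g]
    group
  · intro g h k
    change ω g h k * ((C (g * h) (s k))⁻¹ * (C g (s h))⁻¹) =
      (C g (s (h * k)))⁻¹ * ((C h (s k))⁻¹ * C g (e (w h k)))
    have h₁ := hC g (s h) (s k)
    -- The kernel element relating s(h)s(k) to s(hk) splits off multiplicatively.
    have h₂ := hC_left g (e (w h k)) (s h * s k) (hker _)
    rw [hew, show s (h * k) * (s k)⁻¹ * (s h)⁻¹ * (s h * s k) = s (h * k) by group] at h₂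
    simp only [hs _] at h₁
    rw [hew, h₂]
    have h₃ : C g (s h * s k) =
        (ω g h k)⁻¹ * (C g (s h) * C (g * h) (s k)) * (C h (s k))⁻¹ := by
      rw [← h₁, mul_inv_cancel_right]
    rw [h₃]
    ext
    push_cast
    have n₁ := (C h (s k)).coe_ne_zero
    have n₂ := (C g (s h)).coe_ne_zero
    have n₃ := (C (g * h) (s k)).coe_ne_zero
    have n₄ := (ω g h k).coe_ne_zero
    have n₅ := (C g (s (h * k) * (s k)⁻¹ * (s h)⁻¹)).coe_ne_zero
    field_simp

end CocycleTrivialization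

/-! ### The Schreier index formula -/

section SchreierIndexFormula

variable {Q : Type*} [Group Q] {X A : Type*} [CommGroup A]

/-- The 1-cocycles of the action groupoid of a free group on a quotient `Q`, with values in `A`. -/
def GroupoidCocycle (ρ : FreeGroup X →* Q) (A : Type*) [CommGroup A] : Type _ :=
  {C : FreeGroup X → Q → A // ∀ a b q, C (a * b) q = C a (ρ b * q) * C b q}

/-- A 1-cocycle is determined by its arbitrary values on the generators. -/
theorem GroupoidCocycle.bijective_generators (ρ : FreeGroup X →* Q) :
    Function.Bijective
      (fun (C : GroupoidCocycle ρ A) (x : X) (q : Q) => C.1 (FreeGroup.of x) q) := by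
  have hone : ∀ (C : GroupoidCocycle ρ A) q, C.1 1 q = 1 := fun C q => by
    simpa using C.2 1 1 q
  have hinv : ∀ (C : GroupoidCocycle ρ A) a q, C.1 a⁻¹ q = (C.1 a (ρ a⁻¹ * q))⁻¹ :=
    fun C a q => by
      have := C.2 a a⁻¹ q
      rw [mul_inv_cancel, hone] at this
      exact eq_inv_of_mul_eq_one_right this.symm
  constructor
  · intro C D h
    have h' : ∀ x q, C.1 (FreeGroup.of x) q = D.1 (FreeGroup.of x) q :=
      fun x q => congrFun (congrFun h x) q
    refine Subtype.ext (funext fun a => ?_)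
    induction a using FreeGroup.induction_on with
    | C1 => exact funext fun q => by rw [hone, hone]
    | of x => exact funext (h' x)
    | inv_of x => exact funext fun q => by rw [hinv, hinv, h']
    | mul a b ha hb => exact funext fun q => by rw [C.2, D.2, ha, hb]
  · intro f
    -- Skew products: a cocycle is the fibre part of an action on Q × A lifting that on Q, and a
    -- free group acts by arbitrary permutations of its generators.
    let p : X → Equiv.Perm (Q × A) := fun x =>
      { toFun := fun y => (ρ (FreeGroup.of x) * y.1, f x y.1 * y.2)
        invFun := fun y => ((ρ (FreeGroup.of x))⁻¹ * y.1,
          (f x ((ρ (FreeGroup.of x))⁻¹ * y.1))⁻¹ * y.2)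
        left_inv := fun y => by simp
        right_inv := fun y => by simp }
    let σ : FreeGroup X →* Equiv.Perm (Q × A) := FreeGroup.lift p
    have hp : ∀ x, σ (FreeGroup.of x) = p x := fun x => by simp [σ]
    have hσ : ∀ a y, σ a y = (ρ a * y.1, (σ a (y.1, 1)).2 * y.2) := by
      intro a
      induction a using FreeGroup.induction_on with
      | C1 => simp
      | of x => simp [hp, p]
      | inv_of x =>
        intro y
        simp only [map_inv, hp]
        ext <;> simp [p, Equiv.Perm.inv_def]
      | mul a b ha hb =>
        intro y
        rw [map_mul, Equiv.Perm.mul_apply, Equiv.Perm.mul_apply, hb, ha, hb (y.1, 1),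
          ha (_, _ * 1)]
        simp [mul_assoc]
    refine ⟨⟨fun a q => (σ a (q, 1)).2, fun a b q => ?_⟩, ?_⟩
    · beta_reduce
      rw [map_mul, Equiv.Perm.mul_apply, hσ b, hσ a]
    · funext x q
      simp [hp, p]

/-- A 1-cocycle is determined by its restriction to the kernel and its arbitrary values along
a transversal. -/
theorem GroupoidCocycle.bijective_restrict {ρ : FreeGroup X →* Q} {s : Q → FreeGroup X}
    (hs : ∀ q, ρ (s q) = q) (hs₁ : s 1 = 1) :
    ∃ r : GroupoidCocycle ρ A → (ρ.ker →* A) × ({q : Q // q ≠ 1} → A), Function.Bijective r := by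
  classical
  have hone : ∀ (C : GroupoidCocycle ρ A) q, C.1 1 q = 1 := fun C q => by
    simpa using C.2 1 1 q
  refine ⟨fun C => (⟨⟨fun k => C.1 k 1, hone C 1⟩, fun k l => ?_⟩, fun q => C.1 (s q) 1), ?_, ?_⟩
  · simpa [(MonoidHom.mem_ker).1 l.2] using C.2 k l 1
  · intro C D h
    have h₁ : ∀ k, ρ k = 1 → C.1 k 1 = D.1 k 1 := fun k hk =>
      DFunLike.congr_fun (congrArg Prod.fst h) (⟨k, hk⟩ : ρ.ker)
    have h₂ : ∀ q, C.1 (s q) 1 = D.1 (s q) 1 := fun q => by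
      by_cases hq : q = 1
      · rw [hq, hs₁, hone, hone]
      · exact congrFun (congrArg Prod.snd h) ⟨q, hq⟩
    have h₃ : ∀ a, C.1 a 1 = D.1 a 1 := fun a => by
      have hk : ρ ((s (ρ a))⁻¹ * a) = 1 := by simp [hs]
      rw [← mul_inv_cancel_left (s (ρ a)) a, C.2, D.2, hk, mul_one, h₂, h₁ _ hk]
    refine Subtype.ext (funext fun a => funext fun q => ?_)
    -- Transitivity: values at the base point 1 determine those at q, by moving along `s q`.
    have hC := C.2 a (s q) 1
    have hD := D.2 a (s q) 1
    rw [hs, mul_one] at hC hD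
    rw [h₃, h₂, hD] at hC
    exact (mul_right_cancel hC).symm
  · rintro ⟨χ, t₀⟩
    let t : Q → A := fun q => if h : q = 1 then 1 else t₀ ⟨q, h⟩
    have ht₁ : t 1 = 1 := by simp [t]
    -- The loop at 1 that goes to q along `s`, follows `a`, and returns along `s`.
    let κ : FreeGroup X → Q → ρ.ker := fun a q =>
      ⟨(s (ρ a * q))⁻¹ * a * s q, by simp [MonoidHom.mem_ker, hs]⟩
    refine ⟨⟨fun a q => t (ρ a * q) * χ (κ a q) * (t q)⁻¹, fun a b q => ?_⟩, ?_⟩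
    · have hκ : κ (a * b) q = κ a (ρ b * q) * κ b q := by
        ext1
        simp [κ, mul_assoc]
      beta_reduce
      rw [hκ, map_mul, map_mul, mul_assoc (ρ a)]
      simp only [mul_assoc, inv_mul_cancel_left]
    · refine Prod.ext (MonoidHom.ext fun k => ?_) (funext fun q => ?_)
      · have hk : ρ k = 1 := k.2
        have : κ k 1 = k := by
          ext1
          simp [κ, hk, hs₁]
        simp [this, hk, ht₁]
      · have : κ (s q) 1 = 1 := by
          ext1
          simp [κ, hs, hs₁]
        simp [this, hs, ht₁, t, q.2]

/-- The kernel of a surjection of the free group on `n` generators onto a finite group `Q` is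
free on `|Q| (n - 1) + 1` generators. -/
theorem nonempty_mulEquiv_ker [Finite Q] {n : ℕ} (hn : 0 < n) {ρ : FreeGroup (Fin n) →* Q}
    (hρ : Function.Surjective ρ) :
    Nonempty (FreeGroup (Fin (Nat.card Q * (n - 1) + 1)) ≃* ρ.ker) := by
  obtain ⟨s₀, hs₀⟩ := hρ.hasRightInverse
  -- The section is corrected to send 1 to 1, so only |Q| - 1 transversal values are free. Any
  -- nontrivial finite abelian group could replace ℤ/2.
  obtain ⟨r, hr⟩ := GroupoidCocycle.bijective_restrict (A := Multiplicative (ZMod 2))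
    (ρ := ρ) (s := fun q => s₀ q * (s₀ 1)⁻¹) (fun q => by simp [hs₀ _]) (mul_inv_cancel _)
  let Y := IsFreeGroup.Generators ρ.ker
  let e : (Fin n → Q → Multiplicative (ZMod 2)) ≃
      (Y → Multiplicative (ZMod 2)) × ({q : Q // q ≠ 1} → Multiplicative (ZMod 2)) :=
    ((Equiv.ofBijective _ (GroupoidCocycle.bijective_generators ρ)).symm.trans
      (Equiv.ofBijective r hr)).trans (Equiv.prodCongr IsFreeGroup.lift.symm (Equiv.refl _))
  have : Finite (Y → Multiplicative (ZMod 2)) :=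
    Finite.of_surjective (fun f => (e f).1)
      (Prod.fst_surjective.comp e.surjective)
  have hY : Finite Y := by
    by_contra hY
    rw [not_finite_iff_infinite] at hY
    exact not_finite (Y → Multiplicative (ZMod 2))
  have h2 : Nat.card (Multiplicative (ZMod 2)) = 2 := by simp
  have hcard := Nat.card_congr e
  rw [Nat.card_prod, Nat.card_fun, Nat.card_fun, Nat.card_fun, Nat.card_fun, h2, ← pow_mul,
    ← pow_add, Nat.card_fin] at hcard
  -- Comparing exponents of 2: |Q|n = |Y| + (|Q| - 1).
  have hexp := Nat.pow_right_injective le_rfl hcard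
  have hQ : Nat.card {q : Q // q ≠ 1} + 1 = Nat.card Q := by
    have := Fintype.ofFinite Q
    classical
    rw [Nat.card_eq_fintype_card, Nat.card_eq_fintype_card, Fintype.card_subtype_compl,
      Fintype.card_subtype_eq]
    exact Nat.sub_add_cancel Fintype.card_pos
  have hYcard : Nat.card Y = Nat.card Q * (n - 1) + 1 := by
    obtain ⟨k, rfl⟩ : ∃ k, n = k + 1 := ⟨n - 1, by omega⟩
    rw [Nat.add_sub_cancel]
    rw [mul_add, mul_one] at hexp
    omega
  exact ⟨(FreeGroup.freeGroupCongr
    ((finCongr hYcard.symm).trans (Finite.equivFin Y).symm)).trans (IsFreeGroup.mulEquiv _)⟩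

end SchreierIndexFormula

theorem corollary3p2 {Q : Type*} [Group Q] [Finite Q]
    (ω : Q → Q → Q → Circle) (hω : IsNormalizedThreeCocycle ω)
    (n : ℕ) (hn : 1 < n) (ρ : FreeGroup (Fin n) →* Q) (hρ : Function.Surjective ρ) :
    Nonempty (AnomalousAction ω
      (reducedGroupCStarAlgebra (FreeGroup (Fin (Nat.card Q * (n - 1) + 1))))) := by
  obtain ⟨e⟩ := nonempty_mulEquiv_ker (by omega) hρ
  exact hω.nonempty_anomalousAction hρ e
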